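/- Let $k$ be a nonarchimedean local field of residual characteristic $\neq 2$, with ring of integers $\mathcal R$, maximal ideal $\mathcal P$, uniformizer $\varpi$, residue field $\kappa$ with $q$ elements, and valuation normalized by $\mathrm{val}(\varpi)=1$. Fix a nonsquare unit $\varepsilon$, an additive quasi-character $\Psi$ of $k$ trivial on $\mathcal P$ but not on $\mathcal R$, and $x_0,y_0\in\mathcal R$ with $x_0^2-\varepsilon y_0^2=\varepsilon$. Let $\mathcal G=\mathrm{SL}_2(k)$, $\mathcal K=\mathrm{SL}_2(\mathcal R)$. For $y\in\mathbb R$ and real $r\ge 0$ let $\mathcal G_{y,r}$ (resp. $\mathcal G_{y,r+}$) be the group of $g\in\mathcal G$ with $g_{11}-1,\,g_{22}-1\in\mathcal P^{l}$, $g_{12}\in\mathcal P^{m}$, $g_{21}\in\mathcal P^{n}$, where $l,m,n$ are the least integers $\geq$ (resp. $>$) $r,\ r-y,\ r+y$. The depth of an irreducible smooth representation of $\mathcal K$ is the least real $c\ge 0$ such that it has a nonzero $\mathcal G_{0,c+}$-fixed vector. For $g \in \mathcal G$ and a representation $\sigma$ of $H\le\mathcal G$, put $H^g=gHg^{-1}$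 and $\sigma^g(h)=\sigma(g^{-1}hg)$. *Tori.* Let $(\gamma_1,\gamma_2;y)$ be one of the unramified types $(1,\varepsilon;0)$, $(\varpi^{-1},\varepsilon\varpi;1)$ or one of the ramified types $(1,\varpi;\tfrac12)$, $(\varepsilon,\varepsilon^{-1}\varpi;\tfrac12)$, $(1,\varepsilon\varpi;\tfrac12)$, $(\varepsilon,\varpi;\tfrac12)$. Let $\mathcal T$ be the anisotropic torus of matrices $\begin{pmatrix}a&b\gamma_1\\ b\gamma_2&a\end{pmatrix}$ of determinant $1$ with $a,b\in\mathcal R$, put $X_{\mathcal T}=\begin{pmatrix}0&\gamma_1\\ \gamma_2&0\end{pmatrix}$, and filter $\mathcal T$ by $\mathcal T_r=\mathcal T\cap\mathcal G_{y,r}$, $\mathcal T_{r+}=\mathcal T\cap\mathcal G_{y,r+}$. *The representation $\rho$.* Let $r>0$, $s=r/2$, and let $\phi$ be a $\mathcal G$-generic character of $\mathcal T$ of depth $r$: it is trivial on $\mathcal T_{r+}$, nontrivial on $\mathcal T_r$, and on $\mathcal T_r$ it equals $t\mapsto\Psi(\mathrm{Tr}(\Gamma(t-1)))$ for some $\Gamma=\mathsf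 aX_{\mathcal T}$ with $\mathrm{val}(\mathsf a\gamma_1)=-r-y$. Choose such a $\Gamma=\mathsf aX_{\mathcal T}$ with $\phi(t)=\Psi(\mathrm{Tr}(\Gamma(t-1)))$ for all $t\in\mathcal T_{s+}$. Let $\rho=\rho(\mathcal T,y,r,\phi)$ be the following representation of $\mathcal T\mathcal G_{y,s}$. - If $\mathcal T$ is ramified or $r$ is not an even integer, then $\rho$ is the character $\rho(tg)=\phi(t)\Psi(\mathrm{Tr}(\Gamma(g-1)))$ for $t\in\mathcal T$, $g\in\mathcal G_{y,s}$. - If $\mathcal T$ is unramified and $r$ is an even integer, then $\rho$ is Yu's $q$-dimensional representation $\rho(tj)=\phi(t)\,\omega(M_t)\,\eta(j)$ for $t\in\mathcal T$ and $j\in J^1=\{g\in\mathcal G_{y,s}:\mathrm{Tr}(\Gamma(g-1))\in\mathcal R\}$. Here $\psi$ is the character of $\kappa$ induced by $\Psi$, $\eta(j)$ is the operator $(\eta(j)f)(w)=\psi(\tau+\mathsf q w+\tfrac12\mathsf p\mathsf q)f(w+\mathsf p)$ on functions $f\colon\kappa\to\mathbb C$, where $\mathsf p,\mathsf q,\tau\in\kappa$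 are the reductions of $\varpi^{-s}(j_{11}-1)$, $2\varpi^{s}\mathsf a(\gamma_2j_{12}-\gamma_1j_{21})$, $\mathrm{Tr}(\Gamma(j-1))$; $M_t\in\mathrm{SL}_2(\kappa)$ is the matrix by which conjugation by $t$ on $J^1$ acts on $(\mathsf p,\mathsf q)^{T}$; and $\omega$ is the Weil representation of $\mathrm{SL}_2(\kappa)$ attached to $\psi$. Explicitly, for $M=\begin{pmatrix}A&B\\ C&D\end{pmatrix}$, $(\omega(M)f)(w)=\chi(A)\,\psi\!\left(-\tfrac{C}{2A}w^2\right)f(A^{-1}w)$ if $B=0$, where $\chi$ is the quadratic character of $\kappa^\times$, and $(\omega(M)f)(w)=q^{-1}\Big(\sum_{u\in\kappa}\psi(2Bu^2)\Big)\sum_{u\in\kappa}\psi\!\left(\tfrac{-Dw^2+2wu-Au^2}{2B}\right)f(u)$ if $B\ne0$. *Double coset representatives.* Put $\alpha^t=\mathrm{diag}(\varpi^{-t},\varpi^t)$. Let $\mathsf d$ be $\mathsf e=\begin{pmatrix}x_0&y_0\\ y_0&\varepsilon^{-1}x_0\end{pmatrix}$ if $y=0$, its conjugate $\eta_0\mathsf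 e\eta_0^{-1}$ with $\eta_0=\mathrm{diag}(1,\varpi)$ if $y=1$, and $w=\begin{pmatrix}0&1\\-1&0\end{pmatrix}$ if $y=\tfrac12$. Let $M(\mathcal T)=\{I\}\cup\{\alpha^t\lambda : t\in\mathbb Z_{>0},\ \lambda\in\{I,\mathsf d\}\}$. For $\mu=\alpha^t\lambda\in M(\mathcal T)$ (with $t=0$, $\lambda=I$ if $\mu=I$) put $\delta(\mu)=2t-y$ if $y=\tfrac12$ and $\lambda=w$, and $\delta(\mu)=2t+y$ otherwise. **Proposition.** For every $\rho=\rho(\mathcal T,y,r,\phi)$ as above and every $\mu\in M(\mathcal T)$, the maximum of the depths of the irreducible $\mathcal K$-components of $\mathrm{Ind}_{\mathcal K\cap(\mathcal T\mathcal G_{y,s})^\mu}^{\mathcal K}\rho^\mu$ is $r+\delta(\mu)$. -/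

import Mathlib

open scoped ValuativeRel

namespace SL2Branching

/-! ### The Weil representation of `SL₂` over a finite field, in Schrödinger's model

Here `F` is a finite field of odd characteristic, `ψ` is a nontrivial additive character of `F`, and
`F × F`, with coordinates `(p, q)`, carries the symplectic form `p q' - p' q`. All operators act on
the space of functions `F → ℂ`. -/

section Weil

variable {F : Type*} [Field F]

/-- The Schrödinger model of the Heisenberg representation with central character `ψ`: the element
`(p, q; τ)` acts by `f ↦ (w ↦ ψ (τ + q w + p q / 2) f (w + p))`. One has
`(p, q; τ) (p', q'; τ') = (p + p', q + q'; τ + τ' + (p q' - p' q) / 2)`. -/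
def heisenbergOp (ψ : F → ℂ) (p q τ : F) (f : F → ℂ) : F → ℂ :=
  fun w => ψ (τ + q * w + p * q / 2) * f (w + p)

open Classical in
/-- The Weil representation of `SL₂(F) = Sp₂(F)` attached to `ψ`, on the space of
`heisenbergOp ψ`. For `M = !![A, B; C, D]` the operator intertwines the Heisenberg representation
with its transform by `(p, q)ᵀ ↦ M (p, q)ᵀ`, and it is normalized so as to be multiplicative
in `M`. If `B = 0` then the factor in front is the quadratic character of `A`; if `B ≠ 0` then it
is a quadratic Gauss sum divided by the cardinality of `F`. -/
noncomputable def weilOp (ψ : F → ℂ) (M : Matrix.SpecialLinearGroup (Fin 2) F) (f : F → ℂ) :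
    F → ℂ :=
  fun w =>
    if M 0 1 = 0 then
      (if IsSquare (M 0 0) then 1 else -1) *
        ψ (-(M 1 0 * (M 0 0)⁻¹ * w ^ 2) / 2) * f ((M 0 0)⁻¹ * w)
    else
      ((Nat.card F : ℂ)⁻¹ * ∑ᶠ u : F, ψ (2 * M 0 1 * u ^ 2)) *
        ∑ᶠ u : F, ψ ((-(M 1 1 * w ^ 2) + 2 * w * u - M 0 0 * u ^ 2) / (2 * M 0 1)) * f u

end Weil

/-! ### The field -/

/-- The choices that are fixed once and for all over a nonarchimedean local field `k` with ring of
integers `𝒪[k]`: a uniformizer `ϖ`, a nonsquare unit `ε`, an additive quasi-character `Ψ` of `k`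
that is trivial on the maximal ideal but not on `𝒪[k]`, and a solution in `𝒪[k]` of
`x ^ 2 - ε y ^ 2 = ε`. -/
structure Setup (k : Type*) [Field k] [ValuativeRel k] [TopologicalSpace k]
    [IsNonarchimedeanLocalField k] where
  ϖ : 𝒪[k]
  irreducible_ϖ : Irreducible ϖ
  ε : 𝒪[k]
  isUnit_ε : IsUnit ε
  not_isSquare_ε : ¬ IsSquare (ε : k)
  Ψ : AddChar k ℂ
  Ψ_maximalIdeal : ∀ z : 𝒪[k], z ∈ 𝓂[k] → Ψ (z : k) = 1
  Ψ_integers : ∃ z : 𝒪[k], Ψ (z : k) ≠ 1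
  x : 𝒪[k]
  y : 𝒪[k]
  sq_sub_eq : x ^ 2 - ε * y ^ 2 = ε

/-- The types of anisotropic tori `𝒯_{γ₁, γ₂}` in `SL₂(k)`: in this order,
`(γ₁, γ₂) = (1, ε)`, `(ϖ⁻¹, ε ϖ)`, `(1, ϖ)`, `(ε, ε⁻¹ ϖ)`, `(1, ε ϖ)`, `(ε, ϖ)`.
The first two are unramified, the others ramified. -/
inductive TorusType
  | unram0
  | unram1
  | ram1
  | ram2
  | ram3
  | ram4

namespace TorusType

/-- The torus splits over the unramified quadratic extension. -/
def IsUnramified : TorusType → Prop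
  | unram0 | unram1 => True
  | _ => False

/-- The coordinate in the standard apartment (with origin the vertex of `SL₂(𝒪[k])` and with the
vertices at the integers) of the point of the building that belongs to the torus. -/
noncomputable def point : TorusType → ℝ
  | unram0 => 0
  | unram1 => 1
  | _ => 1 / 2

end TorusType

variable {k : Type*} [Field k] [ValuativeRel k] [TopologicalSpace k] [IsNonarchimedeanLocalField k]

namespace Setup

variable (S : Setup k)

lemma ϖ_ne_zero : (S.ϖ : k) ≠ 0 := by
  have h := S.irreducible_ϖ.ne_zero
  exact fun h' => h (Subtype.ext h')

lemma ε_ne_zero : (S.ε : k) ≠ 0 := by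
  have h := S.isUnit_ε.ne_zero
  exact fun h' => h (Subtype.ext h')

/-- The fractional ideal `𝒫 ^ n = ϖ ^ n 𝒪[k]`. -/
def P (n : ℤ) : AddSubgroup k where
  carrier := {z | (S.ϖ : k) ^ (-n) * z ∈ 𝒪[k]}
  zero_mem' := by simp [zero_mem]
  add_mem' {a b} ha hb := by
    rw [Set.mem_ofPred_eq] at *
    rw [mul_add]
    exact add_mem ha hb
  neg_mem' {a} ha := by
    rw [Set.mem_ofPred_eq] at *
    rw [mul_neg]
    exact neg_mem ha

lemma mem_P {n : ℤ} {z : k} : z ∈ S.P n ↔ (S.ϖ : k) ^ (-n) * z ∈ 𝒪[k] := Iff.rfl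

lemma mul_mem_P {m n : ℤ} {a b : k} (ha : a ∈ S.P m) (hb : b ∈ S.P n) : a * b ∈ S.P (m + n) := by
  rw [mem_P] at *
  have := mul_mem ha hb
  rw [neg_add, zpow_add₀ S.ϖ_ne_zero]
  convert this using 1
  ring

lemma P_mono {m n : ℤ} (h : m ≤ n) {a : k} (ha : a ∈ S.P n) : a ∈ S.P m := by
  rw [mem_P] at *
  obtain ⟨d, rfl⟩ := Int.le.dest h
  have hd : (S.ϖ : k) ^ d ∈ 𝒪[k] := pow_mem S.ϖ.2 d
  have := mul_mem hd ha
  convert this using 1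
  rw [← mul_assoc, ← zpow_natCast, ← zpow_add₀ S.ϖ_ne_zero]
  congr 2
  ring

/-- `z` has valuation `n`. -/
def HasVal (z : k) (n : ℤ) : Prop := ∃ u : 𝒪[k], IsUnit u ∧ z = (S.ϖ : k) ^ n * (u : k)

open Classical in
/-- Reduction modulo the maximal ideal (only used on `𝒪[k]`). -/
noncomputable def red (z : k) : 𝓀[k] :=
  if h : z ∈ 𝒪[k] then IsLocalRing.residue 𝒪[k] ⟨z, h⟩ else 0

/-- The additive character of the residue field that is induced by `Ψ`. -/
noncomputable def ψ (z : 𝓀[k]) : ℂ :=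
  S.Ψ ((Function.surjInv IsLocalRing.residue_surjective z : 𝒪[k]) : k)

/-! ### Filtration subgroups of `SL₂(k)` -/

/-- The matrices of determinant one in `!![1 + 𝒫 ^ l, 𝒫 ^ m; 𝒫 ^ n, 1 + 𝒫 ^ l]`. -/
def congr (l m n : ℤ) (hl : 0 ≤ l) (h : l ≤ m + n) :
    Subgroup (Matrix.SpecialLinearGroup (Fin 2) k) where
  carrier := {g | g 0 0 - 1 ∈ S.P l ∧ g 1 1 - 1 ∈ S.P l ∧ g 0 1 ∈ S.P m ∧ g 1 0 ∈ S.P n}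
  one_mem' := by simp [zero_mem]
  mul_mem' {a b} ha hb := by
    obtain ⟨a1, a2, a3, a4⟩ := ha
    obtain ⟨b1, b2, b3, b4⟩ := hb
    have key : ∀ {z w : k} {i : ℤ}, z ∈ S.P i → w - 1 ∈ S.P l → z * w ∈ S.P i := by
      intro z w i hz hw
      have h1 : z * (w - 1) ∈ S.P i := S.P_mono (by lia) (S.mul_mem_P hz hw)
      have := add_mem h1 hz
      convert this using 1
      ring
    simp only [Set.mem_ofPred_eq, Matrix.SpecialLinearGroup.coe_mul, Matrix.mul_apply,
      Fin.sum_univ_two]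
    refine ⟨?_, ?_, ?_, ?_⟩
    · have := add_mem (add_mem (key a1 b1) b1) (S.P_mono h (S.mul_mem_P a3 b4))
      convert this using 1
      ring
    · have := add_mem (add_mem (key a2 b2) b2)
        (S.P_mono (by lia : l ≤ n + m) (S.mul_mem_P a4 b3))
      convert this using 1
      ring
    · have := add_mem (key b3 a1) (key a3 b2)
      convert this using 1
      ring
    · have := add_mem (key a4 b1) (key b4 a2)
      convert this using 1
      ring
  inv_mem' {a} ha := by
    obtain ⟨a1, a2, a3, a4⟩ := ha
    simp only [Set.mem_ofPred_eq, Matrix.SpecialLinearGroup.coe_inv, Matrix.adjugate_fin_two]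
    exact ⟨by simpa using a2, by simpa using a1, by simpa using neg_mem a3,
      by simpa using neg_mem a4⟩

/-- The maximal compact subgroup `𝒦 = SL₂(𝒪[k])`. -/
def K : Subgroup (Matrix.SpecialLinearGroup (Fin 2) k) := S.congr 0 0 0 le_rfl le_rfl

/-- The Moy--Prasad filtration subgroup `𝒢_{y, r}`, for a point `y` of the standard apartment and
a real number `r ≥ 0`. -/
noncomputable def MP (y r : ℝ) (hr : 0 ≤ r) : Subgroup (Matrix.SpecialLinearGroup (Fin 2) k) :=
  S.congr ⌈r⌉ ⌈r - y⌉ ⌈r + y⌉ (Int.ceil_nonneg hr) <| by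
    rw [Int.ceil_le]
    push_cast
    linarith [Int.le_ceil (r - y), Int.le_ceil (r + y)]

/-- The Moy--Prasad filtration subgroup `𝒢_{y, r+}`, for a point `y` of the standard apartment and
a real number `r ≥ 0`. Note that the least integer that is `> z` is `⌊z⌋ + 1`. -/
noncomputable def MPplus (y r : ℝ) (hr : 0 ≤ r) : Subgroup (Matrix.SpecialLinearGroup (Fin 2) k) :=
  S.congr (⌊r⌋ + 1) (⌊r - y⌋ + 1) (⌊r + y⌋ + 1)
    (by have := Int.floor_nonneg.2 hr; lia) <| by
    have h1 := Int.lt_floor_add_one (r - y)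
    have h2 := Int.lt_floor_add_one (r + y)
    have h3 := Int.floor_le r
    have h4 : (⌊r⌋ : ℝ) < ((⌊r - y⌋ + 1 + (⌊r + y⌋ + 1) : ℤ) : ℝ) := by
      push_cast
      linarith
    have h5 : ⌊r⌋ < ⌊r - y⌋ + 1 + (⌊r + y⌋ + 1) := by exact_mod_cast h4
    lia

/-! ### The anisotropic tori -/

/-- The parameter `γ₁` of a torus. -/
noncomputable def γ₁ : TorusType → k
  | .unram0 => 1
  | .unram1 => (S.ϖ : k)⁻¹
  | .ram1 => 1
  | .ram2 => S.ε
  | .ram3 => 1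
  | .ram4 => S.ε

/-- The parameter `γ₂` of a torus. -/
noncomputable def γ₂ : TorusType → k
  | .unram0 => S.ε
  | .unram1 => S.ε * S.ϖ
  | .ram1 => S.ϖ
  | .ram2 => (S.ε : k)⁻¹ * S.ϖ
  | .ram3 => S.ε * S.ϖ
  | .ram4 => S.ϖ

/-- The torus `𝒯 = 𝒯_{γ₁, γ₂}`: the matrices `!![a, b γ₁; b γ₂, a]` of determinant one with `a`
and `b` in `𝒪[k]`. -/
noncomputable def torus (T : TorusType) : Subgroup (Matrix.SpecialLinearGroup (Fin 2) k) where
  carrier := {g | ∃ a b : 𝒪[k], (g : Matrix (Fin 2) (Fin 2) k) = !![(a : k), b * S.γ₁ T;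
    b * S.γ₂ T, (a : k)]}
  one_mem' := ⟨1, 0, by simp [Matrix.one_fin_two]⟩
  mul_mem' {g h} hg hh := by
    obtain ⟨a, b, hg⟩ := hg
    obtain ⟨c, d, hh⟩ := hh
    have hγ : S.γ₁ T * S.γ₂ T ∈ 𝒪[k] := by
      have h1 := S.ϖ_ne_zero
      have h2 := S.ε_ne_zero
      have h3 := S.ϖ.2
      have h4 := S.ε.2
      cases T <;> simp only [γ₁, γ₂]
      · simp
      · convert h4 using 1
        field_simp
      · simp
      · convert h3 using 1
        field_simp
      · simpa using mul_mem h4 h3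
      · exact mul_mem h4 h3
    refine ⟨a * c + b * d * ⟨_, hγ⟩, a * d + b * c, ?_⟩
    rw [Matrix.SpecialLinearGroup.coe_mul, hg, hh, Matrix.mul_fin_two]
    push_cast
    congr! 3 <;> ring_nf
  inv_mem' {g} hg := by
    obtain ⟨a, b, hg⟩ := hg
    refine ⟨a, -b, ?_⟩
    rw [Matrix.SpecialLinearGroup.coe_inv, hg, Matrix.adjugate_fin_two_of]
    push_cast
    congr! 3 <;> ring_nf

/-- The basis element `X_𝒯` of the Lie algebra of the torus. -/
noncomputable def X (T : TorusType) : Matrix (Fin 2) (Fin 2) k := !![0, S.γ₁ T; S.γ₂ T, 0]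

/-- `Tr (Γ (g - 1))` for `Γ = a X_𝒯`. Here `g - 1` stands for the element `e⁻¹ g` of the Lie algebra;
the two agree to the precision that matters. -/
noncomputable def trΓ (T : TorusType) (a : k) (g : Matrix.SpecialLinearGroup (Fin 2) k) : k :=
  Matrix.trace ((a • S.X T) * ((g : Matrix (Fin 2) (Fin 2) k) - 1))

/-- `Γ = a X_𝒯` is `𝒢`-generic of depth `r`: the valuation of `a γ₁` is `- r - y`. -/
def IsGenericElement (T : TorusType) (r : ℝ) (a : k) : Prop :=
  ∃ n : ℤ, (n : ℝ) = -r - T.point ∧ S.HasVal (a * S.γ₁ T) n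

/-- A `𝒢`-generic character `φ` of the torus, of positive depth `r`. The filtration of the torus is
the intersection with the filtration of `𝒢` at the point `y` of the torus. -/
structure GenericCharacter (T : TorusType) where
  r : ℝ
  r_pos : 0 < r
  φ : S.torus T →* ℂˣ
  trivial : ∀ t : S.torus T, (t : Matrix.SpecialLinearGroup (Fin 2) k) ∈ S.MPplus T.point r r_pos.le →
    φ t = 1
  nontrivial : ∃ t : S.torus T,
    (t : Matrix.SpecialLinearGroup (Fin 2) k) ∈ S.MP T.point r r_pos.le ∧ φ t ≠ 1
  generic : ∃ a : k, S.IsGenericElement T r a ∧ ∀ t : S.torus T,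
    (t : Matrix.SpecialLinearGroup (Fin 2) k) ∈ S.MP T.point r r_pos.le → (φ t : ℂ) = S.Ψ (S.trΓ T a t)

namespace GenericCharacter

variable {S} {T : TorusType} (D : S.GenericCharacter T)

/-- `s = r / 2`. -/
noncomputable def s : ℝ := D.r / 2

lemma s_nonneg : 0 ≤ D.s := by
  have := D.r_pos
  unfold s
  linarith

/-- The group `𝒢_{y, s}`. -/
noncomputable def Gs : Subgroup (Matrix.SpecialLinearGroup (Fin 2) k) :=
  S.MP T.point D.s D.s_nonneg

/-- The group `𝒯 𝒢_{y, s}`. -/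
noncomputable def J : Subgroup (Matrix.SpecialLinearGroup (Fin 2) k) := S.torus T ⊔ D.Gs

/-- `Γ = a X_𝒯` is generic of depth `r` and represents `φ` on `𝒯_{s+}`. -/
def Represents (a : k) : Prop :=
  S.IsGenericElement T D.r a ∧ ∀ t : S.torus T,
    (t : Matrix.SpecialLinearGroup (Fin 2) k) ∈ S.MPplus T.point D.s D.s_nonneg →
      (D.φ t : ℂ) = S.Ψ (S.trΓ T a t)

/-- The case in which `𝒢_{y, s+} ≠ 𝒢_{y, s}`: the torus is unramified and `r` is an even integer. -/
def IsHeisenberg : Prop := T.IsUnramified ∧ ∃ n : ℤ, D.r = 2 * n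

/-- The subgroup `J¹` of `𝒢_{y, s}` on which `Tr (Γ (g - 1))` is integral, as a set. Only used when
`𝒢_{y, s+} ≠ 𝒢_{y, s}`. Then it consists of the elements of `𝒢_{y, s}` that lie in `1 + 𝔱_r + 𝔱^⊥`
up to higher order. -/
def J1 (a : k) : Set (Matrix.SpecialLinearGroup (Fin 2) k) :=
  {g | g ∈ D.Gs ∧ S.trΓ T a g ∈ 𝒪[k]}

/-- First symplectic coordinate on `J¹ / J¹₊`, when `s` is an integer. -/
noncomputable def pCoord (g : Matrix.SpecialLinearGroup (Fin 2) k) : 𝓀[k] :=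
  red ((S.ϖ : k) ^ (-⌈D.s⌉) * (g 0 0 - 1))

/-- Second symplectic coordinate on `J¹ / J¹₊`, when `s` is an integer. It is scaled so that the
form `⟨g, h⟩ = Tr (Γ [g - 1, h - 1])` reduces to the standard form `p q' - p' q`, and then
`g ↦ (pCoord g, qCoord g; red (Tr (Γ (g - 1))))` is a homomorphism from `J¹` to the Heisenberg
group over the residue field. -/
noncomputable def qCoord (a : k) (g : Matrix.SpecialLinearGroup (Fin 2) k) : 𝓀[k] :=
  red ((S.ϖ : k) ^ ⌈D.s⌉ * (2 * a * (S.γ₂ T * g 0 1 - S.γ₁ T * g 1 0)))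

/-- Conjugation by `t` acts on the symplectic plane `J¹ / J¹₊` by the matrix `M`. -/
def ActsBy (a : k) (t : Matrix.SpecialLinearGroup (Fin 2) k)
    (M : Matrix.SpecialLinearGroup (Fin 2) 𝓀[k]) : Prop :=
  ∀ g ∈ D.J1 a, D.pCoord (t * g * t⁻¹) = M 0 0 * D.pCoord g + M 0 1 * D.qCoord a g ∧
    D.qCoord a (t * g * t⁻¹) = M 1 0 * D.pCoord g + M 1 1 * D.qCoord a g

variable {V : Type*} [AddCommGroup V] [Module ℂ V]

/-- `ρ` is (isomorphic to) the representation `ρ(𝒯, y, r, φ)` of `𝒯 𝒢_{y, s}`.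

* If `𝒢_{y, s+} = 𝒢_{y, s}`, then `ρ` is the character `t g ↦ φ(t) Ψ_Γ(g)`, for `t ∈ 𝒯` and
  `g ∈ 𝒢_{y, s}`, where `Ψ_Γ(g) = Ψ (Tr (Γ (g - 1)))`.
* Otherwise `ρ(t j) = φ(t) φ~(t, j)` for `t ∈ 𝒯` and `j ∈ J¹`, where `φ~` is the Heisenberg--Weil
  representation of `𝒯 ⋉ J¹`: the composite of the Heisenberg--Weil representation
  of `SL₂(κ) ⋉ Heis(κ)`, where `κ` is the residue field, with the action of `𝒯` on `J¹ / J¹₊` by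
  conjugation and with the homomorphism from `J¹` to `Heis(κ)`. -/
def IsRho (ρ : Representation ℂ D.J V) : Prop :=
  ∃ a : k, D.Represents a ∧
    (¬ D.IsHeisenberg → Module.finrank ℂ V = 1 ∧
      ∀ (t : S.torus T) (g : D.Gs) (v : V),
        ρ ⟨t * g, Subgroup.mul_mem_sup t.2 g.2⟩ v = ((D.φ t : ℂ) * S.Ψ (S.trΓ T a g)) • v) ∧
    (D.IsHeisenberg → ∃ Φ : V ≃ₗ[ℂ] (𝓀[k] → ℂ),
      ∀ (t : S.torus T) (M : Matrix.SpecialLinearGroup (Fin 2) 𝓀[k]), D.ActsBy a t M →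
        ∀ (j : Matrix.SpecialLinearGroup (Fin 2) k) (hj : j ∈ D.J1 a) (v : V),
          Φ (ρ ⟨t * j, Subgroup.mul_mem_sup t.2 hj.1⟩ v) =
            (D.φ t : ℂ) • weilOp S.ψ M
              (heisenbergOp S.ψ (D.pCoord j) (D.qCoord a j) (red (S.trΓ T a j)) (Φ v)))

end GenericCharacter

/-! ### The double coset representatives -/

/-- The element `diag (ϖ ^ (-t), ϖ ^ t)`. -/
noncomputable def α (t : ℕ) : Matrix.SpecialLinearGroup (Fin 2) k :=
  ⟨!![(S.ϖ : k) ^ (-(t : ℤ)), 0; 0, (S.ϖ : k) ^ t], by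
    have := S.ϖ_ne_zero
    simp [Matrix.det_fin_two, this]⟩

/-- The nontrivial element of `Λ(𝒯)`: the matrix `𝖾 = !![x, y; y, ε⁻¹ x]` if `𝒯 = 𝒯_{1, ε}`, its
conjugate by `diag (1, ϖ)` if `𝒯 = 𝒯_{ϖ⁻¹, ε ϖ}`, and `w = !![0, 1; -1, 0]` if `𝒯` is ramified. -/
noncomputable def d : TorusType → Matrix.SpecialLinearGroup (Fin 2) k
  | .unram0 => ⟨!![(S.x : k), S.y; S.y, (S.ε : k)⁻¹ * S.x], by
      have h := congrArg (Subtype.val) S.sq_sub_eq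
      have h0 := S.ε_ne_zero
      push_cast at h
      rw [Matrix.det_fin_two_of]
      field_simp
      linear_combination h⟩
  | .unram1 => ⟨!![(S.x : k), S.y * (S.ϖ : k)⁻¹; S.ϖ * S.y, (S.ε : k)⁻¹ * S.x], by
      have h := congrArg (Subtype.val) S.sq_sub_eq
      have h0 := S.ε_ne_zero
      have h1 := S.ϖ_ne_zero
      push_cast at h
      rw [Matrix.det_fin_two_of]
      field_simp
      linear_combination h⟩
  | _ => ⟨!![0, 1; -1, 0], by simp [Matrix.det_fin_two_of]⟩

end Setup

/-- The index set of `M(𝒯) = {I} ∪ {α ^ t λ | t > 0, λ ∈ Λ(𝒯)}`: `one` is the identity matrix, and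
`mk t _ b` is `α ^ t λ`, where `λ` is the nontrivial element of `Λ(𝒯)` if `b` is true and the
identity matrix otherwise. -/
inductive CosetRep
  | one
  | mk (t : ℕ) (ht : 0 < t) (b : Bool)

/-- The matrix `μ ∈ M(𝒯)`. -/
noncomputable def CosetRep.toSL (S : Setup k) (T : TorusType) :
    CosetRep → Matrix.SpecialLinearGroup (Fin 2) k
  | one => 1
  | mk t _ b => S.α t * (if b then S.d T else 1)

open Classical in
/-- The number `δ(μ)`: it is `2 t - y` if `y = 1 / 2` and `λ = w`, and `2 t + y` otherwise, where
`t = 0` if `μ = I`. -/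
noncomputable def CosetRep.δ (T : TorusType) : CosetRep → ℝ
  | one => T.point
  | mk t _ b => if T.point = 1 / 2 ∧ b = true then 2 * t - T.point else 2 * t + T.point

/-! ### Conjugation, induction, depth -/

section Representations

variable {G : Type*} [Group G] {V : Type*} [AddCommGroup V] [Module ℂ V]

/-- The subgroup `K ∩ H ^ μ` of `K`, where `H ^ μ = μ H μ⁻¹`. -/
def interConj (K H : Subgroup G) (μ : G) : Subgroup K :=
  (H.map (MulAut.conj μ).toMonoidHom).subgroupOf K

/-- The homomorphism `h ↦ μ⁻¹ h μ` from `K ∩ H ^ μ` to `H`. -/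
def conjBack (K H : Subgroup G) (μ : G) : interConj K H μ →* H where
  toFun h := ⟨μ⁻¹ * h * μ, by
    obtain ⟨x, hx, hxh⟩ := h.2
    have : (x : G) = μ⁻¹ * h * μ := by
      have h' : μ * x * μ⁻¹ = ((h : K) : G) := hxh
      rw [← h']
      group
    rw [← this]
    exact hx⟩
  map_one' := by simp
  map_mul' a b := by
    ext
    simp [mul_assoc]

/-- The representation `Ind_{K ∩ H ^ μ}^K ρ ^ μ`, where `ρ ^ μ h = ρ (μ⁻¹ h μ)`: the functions
`f : K → V` with `f (h g) = ρ ^ μ h (f g)` for `h ∈ K ∩ H ^ μ`, with `K` acting by right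
translation. -/
noncomputable def mackeyComponent (K H : Subgroup G) (ρ : Representation ℂ H V) (μ : G) :
    Representation ℂ K
      (Representation.coindV (interConj K H μ).subtype (ρ.comp (conjBack K H μ))) :=
  Representation.coind (interConj K H μ).subtype (ρ.comp (conjBack K H μ))

end Representations

/-- The representation `σ` of `𝒦 = 𝒢₀` has depth `d`: the least real number `c ≥ 0` such
that there is a nonzero vector that is invariant under `𝒢_{0, c+}` is `d`. -/
def HasDepth (S : Setup k) {W : Type*} [AddCommGroup W] [Module ℂ W]
    (σ : Representation ℂ S.K W) (d : ℝ) : Prop :=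
  IsLeast {c : ℝ | ∃ hc : 0 ≤ c, ∃ v : W, v ≠ 0 ∧
    ∀ g : S.K, (g : Matrix.SpecialLinearGroup (Fin 2) k) ∈ S.MPplus 0 c hc → σ g v = v} d

/-- The set of the depths of the irreducible `𝒦`-components (irreducible subrepresentations) of a
representation `σ` of `𝒦`. -/
def componentDepths (S : Setup k) {A : Type*} [AddCommGroup A] [Module ℂ A]
    (σ : Representation ℂ S.K A) : Set ℝ :=
  {d | ∃ W : Subrepresentation σ,
    Representation.IsIrreducible W.toRepresentation ∧ HasDepth S W.toRepresentation d}

end SL2Branching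

/-! Write $n=r+\delta(\mu)$ and let $K_m$ be the principal congruence subgroup of level $m$ in
$\mathcal K$. Everything reduces to showing that the induced representation $\sigma$ is trivial on
$K_{n+1}$ but not on $K_n$ (`exists_level_mackeyComponent`). Granting this, $\sigma$ factors through
a finite quotient of $\mathcal K$. Every component is trivial on $K_{n+1}=\mathcal G_{0,n+}$, so it
has depth at most $n$. The $K_n$-fixed vectors form a proper subrepresentation because $K_n$ is
normal, so by Maschke some irreducible component meets them only in $0$; its depth is exactly $n$
(`isGreatest_componentDepths`).

The exact level depends only on the restriction of $\rho$ to $\mathcal G_{y,r}$, where $\rho$ is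
scalar, given by $\Psi_\Gamma$, in the Heisenberg case too (`IsRho.exists_apply_eq`). Conjugation by
$\alpha^{-t}$ multiplies the lower left entry by $\varpi^{-2t}$ and the upper right one by
$\varpi^{2t}$, so the lower left entry decides. After conjugation by $\lambda$, its coefficient in
$\mathrm{Tr}(\Gamma(g-1))$ has valuation $-N$, where $N=r+y$, or $N=r-y$ if $\lambda=w$ swaps the
two off-diagonal entries (`GenericCharacter.exists_level`). Hence $n=N+2t$. Triviality on $K_{n+1}$
follows from $\mu^{-1}K_{n+1}\mu\subseteq\mathcal G_{y,r+}$; nontriviality on $K_n$ is detected by a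
lower unipotent matrix. -/

namespace SL2Branching

/-! ### Semisimplicity of representations that factor through a finite group -/

section FiniteQuotient

variable {G A : Type*} [Group G] [AddCommGroup A] [Module ℂ A]

/-- The vectors that are fixed by a normal subgroup form a subrepresentation. -/
def fixedSubrepresentation (τ : Representation ℂ G A) (M : Subgroup G) [M.Normal] :
    Subrepresentation τ where
  toSubmodule :=
    { carrier := {v | ∀ m ∈ M, τ m v = v}
      add_mem' := fun ha hb m hm => by rw [map_add, ha m hm, hb m hm]
      zero_mem' := fun m _ => map_zero _
      smul_mem' := fun c v hv m hm => by rw [map_smul, hv m hm] }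
  apply_mem_toSubmodule g v hv m hm := by
    have h := hv (g⁻¹ * m * g) (by simpa using ‹M.Normal›.conj_mem m hm g⁻¹)
    calc τ m (τ g v) = τ (m * g) v := by simp
      _ = τ (g * (g⁻¹ * m * g)) v := by congr 2; group
      _ = τ g v := by rw [map_mul, Module.End.mul_apply, h]

/-- A subrepresentation of `W` is also one of `τ` lying below `W`, so minimality of `W` leaves only
the two trivial choices. -/
lemma isIrreducible_of_isAtom {τ : Representation ℂ G A} {W : Subrepresentation τ}
    (hW : IsAtom W) : W.toRepresentation.IsIrreducible := by
  have hbot : W.toSubmodule ≠ ⊥ := fun h => hW.1 (Subrepresentation.toSubmodule_injective h)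
  have : Nontrivial (Subrepresentation W.toRepresentation) := by
    refine ⟨⊥, ⊤, fun h => hbot ?_⟩
    rw [eq_bot_iff]
    intro v hv
    have h1 : (⟨v, hv⟩ : W.toSubmodule) ∈ (⊤ : Submodule ℂ W.toSubmodule) := trivial
    rw [← show (⊥ : Subrepresentation W.toRepresentation).toSubmodule = ⊤ from
      congrArg Subrepresentation.toSubmodule h] at h1
    have h2 : (⟨v, hv⟩ : W.toSubmodule) = 0 := h1
    simpa using congrArg Subtype.val h2
  refine ⟨fun X => ?_⟩
  let Y : Subrepresentation τ := ⟨X.toSubmodule.map W.toSubmodule.subtype, by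
    rintro g _ ⟨x, hx, rfl⟩
    exact ⟨_, X.apply_mem_toSubmodule g hx, rfl⟩⟩
  have hYW : Y ≤ W := by
    rintro _ ⟨x, -, rfl⟩
    exact x.2
  rcases hW.le_iff.1 hYW with h | h
  · left
    apply Subrepresentation.toSubmodule_injective
    have h1 : X.toSubmodule.map W.toSubmodule.subtype = ⊥ :=
      congrArg Subrepresentation.toSubmodule h
    exact Submodule.map_injective_of_injective W.toSubmodule.injective_subtype
      (h1.trans (Submodule.map_bot _).symm)
  · right
    apply Subrepresentation.toSubmodule_injective
    rw [show (⊤ : Subrepresentation W.toRepresentation).toSubmodule = ⊤ from rfl, eq_top_iff]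
    rintro ⟨x, hx⟩ -
    have h1 : x ∈ Y.toSubmodule := by rw [h]; exact hx
    obtain ⟨x', hx', rfl⟩ := h1
    exact hx'

/-- By Maschke the simple submodules span the whole space, whatever its dimension; if all of them
lay in `F`, then `F` would be everything. -/
lemma exists_isAtom_not_le (Q : Type*) [Group Q] [Finite Q] (τ : Representation ℂ Q A)
    {F : Subrepresentation τ} (hF : F ≠ ⊤) : ∃ W : Subrepresentation τ, IsAtom W ∧ ¬ W ≤ F := by
  have : NeZero (Nat.card Q : ℂ) := ⟨by simp [Nat.card_pos.ne']⟩
  by_contra! h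
  apply hF
  let e := Subrepresentation.subrepresentationSubmoduleOrderIso (ρ := τ)
  have hs := IsSemisimpleModule.sSup_simples_eq_top (MonoidAlgebra ℂ Q) τ.asModule
  have : (⊤ : Submodule (MonoidAlgebra ℂ Q) τ.asModule) ≤ e F := by
    rw [← hs]
    apply sSup_le
    intro m hm
    have hm' : IsAtom m := isSimpleModule_iff_isAtom.1 hm
    have := h (e.symm m) ((e.symm.isAtom_iff m).2 hm')
    rwa [← e.le_iff_le, e.apply_symm_apply] at this
  rw [top_le_iff] at this
  rw [← e.symm_apply_apply F, this, map_top]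

/-- A representation that factors through a finite group and on which a normal subgroup `M` does
not act trivially has an irreducible subrepresentation without nonzero `M`-fixed vectors. -/
lemma exists_irreducible_no_fixed (σ : Representation ℂ G A) (N M : Subgroup G) [N.Normal]
    [M.Normal] [N.FiniteIndex] (hN : ∀ g ∈ N, σ g = 1) {m : G} (hm : m ∈ M) {v : A}
    (hv : σ m v ≠ v) :
    ∃ W : Subrepresentation σ, W.toRepresentation.IsIrreducible ∧
      ∀ w ∈ W.toSubmodule, (∀ g ∈ M, σ g w = w) → w = 0 := by
  -- Passing to the finite quotient changes the group but not the invariant subspaces; `e` records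
  -- this.
  let τ : Representation ℂ (G ⧸ N) A := QuotientGroup.lift N σ hN
  have hτ : ∀ g : G, τ g = σ g := fun g => rfl
  let e : Subrepresentation σ ≃o Subrepresentation τ :=
    { toFun := fun W => ⟨W.toSubmodule, by
        intro q
        induction q using QuotientGroup.induction_on with
        | H g => exact W.apply_mem_toSubmodule g⟩
      invFun := fun W => ⟨W.toSubmodule, fun g => W.apply_mem_toSubmodule (g : G ⧸ N)⟩
      left_inv := fun _ => rfl
      right_inv := fun _ => rfl
      map_rel_iff' := Iff.rfl }
  have hF : e (fixedSubrepresentation σ M) ≠ ⊤ := by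
    rw [Ne, map_eq_top_iff]
    intro h
    have h1 : v ∈ (fixedSubrepresentation σ M).toSubmodule := by rw [h]; trivial
    exact hv (h1 m hm)
  obtain ⟨W, hW, hWF⟩ := exists_isAtom_not_le _ τ hF
  have hW' : IsAtom (e.symm W) := (e.symm.isAtom_iff W).2 hW
  refine ⟨e.symm W, isIrreducible_of_isAtom hW', fun w hw hfix => ?_⟩
  -- An atom not contained in the subrepresentation of `M`-fixed vectors meets it in zero.
  have hbot : e.symm W ⊓ fixedSubrepresentation σ M = ⊥ := by
    refine (hW'.le_iff.1 inf_le_left).resolve_right fun h => hWF ?_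
    rw [← e.symm.le_iff_le, e.symm_apply_apply]
    exact inf_eq_left.1 h
  have h1 : w ∈ (e.symm W ⊓ fixedSubrepresentation σ M).toSubmodule := ⟨hw, hfix⟩
  rw [hbot] at h1
  exact h1

end FiniteQuotient

/-! ### Kernel of an induced representation -/

section Induction

variable {G : Type*} [Group G] {V : Type*} [AddCommGroup V] [Module ℂ V]

/-- For `f` in the induced space, `f (x g) = f ((x g x⁻¹) x) = ρ^μ (x g x⁻¹) (f x)`; normality keeps
`x g x⁻¹` in `N`, where `ρ^μ` is trivial. -/
lemma mackeyComponent_eq_one {K H : Subgroup G} {ρ : Representation ℂ H V} {μ : G}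
    {N : Subgroup K} [hN : N.Normal]
    (h : ∀ g ∈ N, ∃ hg : μ⁻¹ * g * μ ∈ H, ρ ⟨_, hg⟩ = 1) {g : K} (hg : g ∈ N) :
    mackeyComponent K H ρ μ g = 1 := by
  ext f x
  change f.1 (x * g) = f.1 x
  have hx := hN.conj_mem g hg x
  obtain ⟨hH, h1⟩ := h _ hx
  have hmem : x * g * x⁻¹ ∈ interConj K H μ := by
    refine ⟨_, hH, ?_⟩
    simp [mul_assoc]
  have := f.2 ⟨_, hmem⟩ x
  rw [show x * g = x * g * x⁻¹ * x by group]
  refine this.trans ?_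
  change ρ (conjBack K H μ ⟨_, hmem⟩) (f.1 x) = _
  have h2 : conjBack K H μ ⟨_, hmem⟩ = ⟨_, hH⟩ := rfl
  rw [h2, h1]
  rfl

-- The witness is the function supported on `K ∩ H ^ μ` with value `v` at `1`: its translate by `g`
-- has value `ρ^μ g v ≠ v` there.
open Classical in
lemma exists_mackeyComponent_ne {K H : Subgroup G} {ρ : Representation ℂ H V} {μ : G} {g : K}
    (hg : μ⁻¹ * g * μ ∈ H) {v : V} (hv : ρ ⟨_, hg⟩ v ≠ v) :
    ∃ f, mackeyComponent K H ρ μ g f ≠ f := by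
  let f : K → V := fun x =>
    if hx : x ∈ interConj K H μ then ρ (conjBack K H μ ⟨x, hx⟩) v else 0
  have hf : f ∈ Representation.coindV (interConj K H μ).subtype (ρ.comp (conjBack K H μ)) := by
    intro a x
    by_cases hx : x ∈ interConj K H μ
    · have hax : (a : K) * x ∈ interConj K H μ := mul_mem a.2 hx
      have : f ((a : K) * x) = ρ (conjBack K H μ (a * ⟨x, hx⟩)) v := dif_pos hax
      change f ((a : K) * x) = _
      rw [this, map_mul, map_mul, show f x = ρ (conjBack K H μ ⟨x, hx⟩) v from dif_pos hx]
      rfl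
    · have hax : (a : K) * x ∉ interConj K H μ := fun h =>
        hx (by simpa using mul_mem (inv_mem a.2) h)
      change f ((a : K) * x) = _
      rw [show f ((a : K) * x) = 0 from dif_neg hax, show f x = 0 from dif_neg hx, map_zero]
  refine ⟨⟨f, hf⟩, fun h => hv ?_⟩
  have h1 : f (1 * g) = f 1 := congrFun (congrArg Subtype.val h) 1
  have hmem : g ∈ interConj K H μ := by
    refine ⟨_, hg, ?_⟩
    simp [mul_assoc]
  rw [one_mul, show f g = ρ (conjBack K H μ ⟨g, hmem⟩) v from dif_pos hmem,
    show f 1 = ρ (conjBack K H μ 1) v from dif_pos (one_mem _)] at h1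
  simp only [map_one, Module.End.one_apply] at h1
  exact h1

end Induction

variable {k : Type*} [Field k] [ValuativeRel k] [TopologicalSpace k] [IsNonarchimedeanLocalField k]

namespace Setup

variable (S : Setup k)

/-! ### Fractional ideals, valuations and reduction -/

section Valuation

lemma mem_P_zero {z : k} : z ∈ S.P 0 ↔ z ∈ 𝒪[k] := by simp [mem_P]

lemma mul_mem_P_of_le {m n l : ℤ} (h : l ≤ m + n) {a b : k} (ha : a ∈ S.P m) (hb : b ∈ S.P n) :
    a * b ∈ S.P l :=
  S.P_mono h (S.mul_mem_P ha hb)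

lemma zpow_mem_P (n : ℤ) : (S.ϖ : k) ^ n ∈ S.P n := by
  rw [mem_P, ← zpow_add₀ S.ϖ_ne_zero]
  simp [one_mem]

lemma mem_P_one {z : k} (hz : z ∈ S.P 1) : ∃ u : 𝒪[k], u ∈ 𝓂[k] ∧ z = u := by
  refine ⟨S.ϖ * ⟨_, hz⟩, Ideal.mul_mem_right _ _ ?_, ?_⟩
  · exact (IsLocalRing.mem_maximalIdeal _).2 S.irreducible_ϖ.not_isUnit
  · have := S.ϖ_ne_zero
    push_cast
    rw [← mul_assoc, zpow_neg_one, mul_inv_cancel₀ this, one_mul]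

lemma Ψ_eq_one {z : k} (hz : z ∈ S.P 1) : S.Ψ z = 1 := by
  obtain ⟨u, hu, rfl⟩ := S.mem_P_one hz
  exact S.Ψ_maximalIdeal u hu

lemma red_eq_zero {z : k} (hz : z ∈ S.P 1) : red z = 0 := by
  obtain ⟨u, hu, rfl⟩ := S.mem_P_one hz
  rw [red, dif_pos u.2]
  exact (IsLocalRing.residue_eq_zero_iff _).2 hu

/-- `ψ` is defined through an arbitrary lift to the integers. Two lifts differ by an element of the
maximal ideal, on which `Ψ` is trivial. -/
lemma ψ_red {z : k} (hz : z ∈ 𝒪[k]) : S.ψ (red z) = S.Ψ z := by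
  rw [red, dif_pos hz, ψ]
  set u := Function.surjInv IsLocalRing.residue_surjective
    (IsLocalRing.residue 𝒪[k] ⟨z, hz⟩) with hu
  have h1 : IsLocalRing.residue 𝒪[k] (u - ⟨z, hz⟩) = 0 := by
    rw [map_sub, hu, Function.surjInv_eq IsLocalRing.residue_surjective, sub_self]
  have h2 := S.Ψ_maximalIdeal _ ((IsLocalRing.residue_eq_zero_iff _).1 h1)
  have h3 : (u : k) = ((u - ⟨z, hz⟩ : 𝒪[k]) : k) + z := by push_cast; ring
  rw [h3, AddChar.map_add_eq_mul, h2, one_mul]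

lemma ψ_zero : S.ψ 0 = 1 := by
  rw [← S.red_eq_zero (zero_mem (S.P 1)), S.ψ_red (zero_mem _), AddChar.map_zero_eq_one]

variable {S}

lemma HasVal.mem_P {z : k} {n : ℤ} (h : S.HasVal z n) : z ∈ S.P n := by
  obtain ⟨u, -, rfl⟩ := h
  simpa using S.mul_mem_P (S.zpow_mem_P n) (S.mem_P_zero.2 u.2)

lemma HasVal.ne_zero {z : k} {n : ℤ} (h : S.HasVal z n) : z ≠ 0 := by
  obtain ⟨u, hu, rfl⟩ := h
  refine mul_ne_zero (zpow_ne_zero _ S.ϖ_ne_zero) fun h => hu.ne_zero (Subtype.ext h)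

lemma HasVal.mul {z w : k} {m n : ℤ} (hz : S.HasVal z m) (hw : S.HasVal w n) :
    S.HasVal (z * w) (m + n) := by
  obtain ⟨u, hu, rfl⟩ := hz
  obtain ⟨v, hv, rfl⟩ := hw
  refine ⟨u * v, hu.mul hv, ?_⟩
  rw [zpow_add₀ S.ϖ_ne_zero]
  push_cast
  ring

lemma HasVal.inv {z : k} {n : ℤ} (hz : S.HasVal z n) : S.HasVal z⁻¹ (-n) := by
  obtain ⟨u, hu, rfl⟩ := hz
  obtain ⟨v, huv⟩ := hu.exists_right_inv
  have h1 : (u : k) * v = 1 := by exact_mod_cast congrArg Subtype.val huv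
  refine ⟨v, IsUnit.of_mul_eq_one_right _ huv, ?_⟩
  rw [mul_inv, zpow_neg, inv_eq_of_mul_eq_one_right h1]

variable (S)

lemma hasVal_unit {u : 𝒪[k]} (hu : IsUnit u) : S.HasVal (u : k) 0 := ⟨u, hu, by simp⟩

lemma hasVal_ϖ : S.HasVal (S.ϖ : k) 1 := ⟨1, isUnit_one, by simp⟩

lemma hasVal_ε : S.HasVal (S.ε : k) 0 := S.hasVal_unit S.isUnit_ε

end Valuation

/-! ### Congruence and filtration subgroups -/

section Groups

lemma mem_congr {l m n : ℤ} {hl : 0 ≤ l} {h : l ≤ m + n}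
    {g : Matrix.SpecialLinearGroup (Fin 2) k} :
    g ∈ S.congr l m n hl h ↔
      g 0 0 - 1 ∈ S.P l ∧ g 1 1 - 1 ∈ S.P l ∧ g 0 1 ∈ S.P m ∧ g 1 0 ∈ S.P n := Iff.rfl

lemma congr_mono {l m n l' m' n' : ℤ} {hl : 0 ≤ l} {h : l ≤ m + n} {hl' : 0 ≤ l'}
    {h' : l' ≤ m' + n'} (h1 : l ≤ l') (h2 : m ≤ m') (h3 : n ≤ n') :
    S.congr l' m' n' hl' h' ≤ S.congr l m n hl h := fun _ hg =>
  ⟨S.P_mono h1 hg.1, S.P_mono h1 hg.2.1, S.P_mono h2 hg.2.2.1, S.P_mono h3 hg.2.2.2⟩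

/-- The parahoric subgroup at the integral point `y` of the apartment normalizes the filtration
subgroups at `y`. -/
lemma conj_mem_congr {y l m n : ℤ} {hl : 0 ≤ l} {h : l ≤ m + n} (hm : m = l - y) (hn : n = l + y)
    {p g : Matrix.SpecialLinearGroup (Fin 2) k}
    (hp : p ∈ S.congr 0 (-y) y le_rfl (by lia)) (hg : g ∈ S.congr l m n hl h) :
    p * g * p⁻¹ ∈ S.congr l m n hl h := by
  subst hm hn
  obtain ⟨p1, p2, p3, p4⟩ := hp
  obtain ⟨g1, g2, g3, g4⟩ := hg
  have h1 : (1 : k) ∈ S.P 0 := S.mem_P_zero.2 (one_mem _)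
  have p1 : p 0 0 ∈ S.P 0 := by simpa using add_mem p1 h1
  have p2 : p 1 1 ∈ S.P 0 := by simpa using add_mem p2 h1
  have hdet : p 0 0 * p 1 1 - p 0 1 * p 1 0 = 1 := by
    rw [← Matrix.det_fin_two, p.det_coe]
  have key : ∀ {x y z : k} {a b c d : ℤ}, x ∈ S.P a → y ∈ S.P b → z ∈ S.P c → d = a + b + c →
      x * y * z ∈ S.P d := by
    rintro x y z a b c d hx hy hz rfl
    exact S.mul_mem_P (S.mul_mem_P hx hy) hz
  rw [mem_congr]
  simp only [Matrix.SpecialLinearGroup.coe_mul, Matrix.SpecialLinearGroup.coe_inv,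
    Matrix.adjugate_fin_two, Matrix.mul_apply, Fin.sum_univ_two, Matrix.of_apply, Matrix.cons_val',
    Matrix.cons_val_zero, Matrix.cons_val_one, Matrix.cons_val_fin_one]
  refine ⟨?_, ?_, ?_, ?_⟩
  -- Entrywise, $pgp^{-1}-1=p(g-1)p^{-1}$; on the diagonal `hdet` accounts for the identity matrix.
  -- The valuations of the factors add up to the required level.
  · have := sub_mem (add_mem (key p1 g1 p2 (by lia)) (key p3 g4 p2 (by lia) : _ ∈ S.P l))
      (add_mem (key p1 g3 p4 (by lia)) (key p3 g2 p4 (by lia)))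
    convert this using 1
    linear_combination hdet
  · have := sub_mem (add_mem (key p4 g3 p1 (by lia)) (key p2 g2 p1 (by lia) : _ ∈ S.P l))
      (add_mem (key p4 g1 p3 (by lia)) (key p2 g4 p3 (by lia)))
    convert this using 1
    linear_combination hdet
  · have := sub_mem (add_mem (key p1 g3 p1 (by lia)) (key p3 g2 p1 (by lia) : _ ∈ S.P (l - y)))
      (add_mem (key p1 g1 p3 (by lia)) (key p3 g4 p3 (by lia)))
    convert this using 1
    ring
  · have := sub_mem (add_mem (key p4 g1 p2 (by lia)) (key p2 g4 p2 (by lia) : _ ∈ S.P (l + y)))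
      (add_mem (key p4 g3 p4 (by lia)) (key p2 g2 p4 (by lia)))
    convert this using 1
    ring

/-- The principal congruence subgroup of level `m`, as a subgroup of `SL₂(k)`. -/
def principal (m : ℕ) : Subgroup (Matrix.SpecialLinearGroup (Fin 2) k) :=
  S.congr m m m (by lia) (by lia)

lemma principal_le_K (m : ℕ) : S.principal m ≤ S.K := S.congr_mono (by lia) (by lia) (by lia)

instance normal_principal (m : ℕ) : ((S.principal m).subgroupOf S.K).Normal :=
  ⟨fun g hg p => by
    rw [Subgroup.mem_subgroupOf] at *
    exact S.conj_mem_congr (y := 0) (by simp) (by simp) p.2 hg⟩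

lemma entry_mem_of_mem_K {g : Matrix.SpecialLinearGroup (Fin 2) k} (hg : g ∈ S.K) (i j : Fin 2) :
    g i j ∈ 𝒪[k] := by
  rw [← S.mem_P_zero]
  have h1 : (1 : k) ∈ S.P 0 := S.mem_P_zero.2 (one_mem _)
  obtain ⟨a, b, c, d⟩ := hg
  fin_cases i <;> fin_cases j
  · simpa using add_mem a h1
  · exact c
  · exact d
  · simpa using add_mem b h1

/-- The entries modulo $\varpi^m$ take finitely many values and separate the cosets. -/
instance finiteIndex_principal (m : ℕ) : ((S.principal m).subgroupOf S.K).FiniteIndex := by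
  let I : Ideal 𝒪[k] := Ideal.span {S.ϖ} ^ m
  have hI : Finite (𝒪[k] ⧸ I) := by
    have : Finite (𝒪[k] ⧸ Ideal.span {S.ϖ}) := by
      rw [← S.irreducible_ϖ.maximalIdeal_eq]
      exact inferInstanceAs (Finite 𝓀[k])
    exact Ideal.finite_quotient_pow ⟨{S.ϖ}, by simp⟩ m
  let f : S.K → Fin 2 → Fin 2 → 𝒪[k] ⧸ I := fun g i j =>
    Ideal.Quotient.mk I ⟨_, S.entry_mem_of_mem_K g.2 i j⟩
  have hf : ∀ g h : S.K, f g = f h → g⁻¹ * h ∈ (S.principal m).subgroupOf S.K := by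
    intro g h hgh
    have key : ∀ i j, (h : Matrix.SpecialLinearGroup (Fin 2) k) i j -
        (g : Matrix.SpecialLinearGroup (Fin 2) k) i j ∈ S.P m := by
      intro i j
      have h1 := (Ideal.Quotient.eq.1 (congrFun (congrFun hgh i) j).symm)
      rw [show I = Ideal.span {S.ϖ ^ m} from Ideal.span_singleton_pow _ _,
        Ideal.mem_span_singleton] at h1
      obtain ⟨c, hc⟩ := h1
      have h2 := congrArg Subtype.val hc
      push_cast at h2
      rw [h2, ← zpow_natCast]
      simpa using S.mul_mem_P (S.zpow_mem_P m) (S.mem_P_zero.2 c.2)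
    have hg0 : ∀ i j, (g : Matrix.SpecialLinearGroup (Fin 2) k) i j ∈ S.P 0 := fun i j =>
      S.mem_P_zero.2 (S.entry_mem_of_mem_K g.2 i j)
    have hdet : (g : Matrix.SpecialLinearGroup (Fin 2) k) 0 0 *
        (g : Matrix.SpecialLinearGroup (Fin 2) k) 1 1 -
        (g : Matrix.SpecialLinearGroup (Fin 2) k) 0 1 *
        (g : Matrix.SpecialLinearGroup (Fin 2) k) 1 0 = 1 := by
      rw [← Matrix.det_fin_two, Matrix.SpecialLinearGroup.det_coe]
    have key2 : ∀ i j i' j', (g : Matrix.SpecialLinearGroup (Fin 2) k) i j *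
        ((h : Matrix.SpecialLinearGroup (Fin 2) k) i' j' -
        (g : Matrix.SpecialLinearGroup (Fin 2) k) i' j') ∈ S.P m := fun i j i' j' =>
      S.mul_mem_P_of_le (by lia) (hg0 i j) (key i' j')
    rw [Subgroup.mem_subgroupOf, principal, mem_congr]
    simp only [Subgroup.coe_mul, Subgroup.coe_inv, Matrix.SpecialLinearGroup.coe_mul,
      Matrix.SpecialLinearGroup.coe_inv,
      Matrix.adjugate_fin_two, Matrix.mul_apply, Fin.sum_univ_two, Matrix.of_apply, Matrix.cons_val',
      Matrix.cons_val_zero, Matrix.cons_val_one, Matrix.cons_val_fin_one]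
    refine ⟨?_, ?_, ?_, ?_⟩
    -- These are the entries of $g^{-1}h-1=g^{-1}(h-g)$.
    · convert sub_mem (key2 1 1 0 0) (key2 0 1 1 0) using 1
      linear_combination hdet
    · convert sub_mem (key2 0 0 1 1) (key2 1 0 0 1) using 1
      linear_combination hdet
    · convert sub_mem (key2 1 1 0 1) (key2 0 1 1 1) using 1
      ring
    · convert sub_mem (key2 0 0 1 0) (key2 1 0 0 0) using 1
      ring
  have : Finite (S.K ⧸ (S.principal m).subgroupOf S.K) := by
    refine Finite.of_injective (fun q => f q.out) fun q q' hq => ?_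
    rw [← q.out_eq', ← q'.out_eq']
    exact QuotientGroup.eq.2 (hf _ _ hq)
  exact Subgroup.finiteIndex_of_finite_quotient

lemma MP_mono {y r s : ℝ} {hr : 0 ≤ r} {hs : 0 ≤ s} (h : s ≤ r) : S.MP y r hr ≤ S.MP y s hs :=
  S.congr_mono (Int.ceil_mono h) (Int.ceil_mono (by linarith)) (Int.ceil_mono (by linarith))

lemma MPplus_le_MP {y r : ℝ} {hr : 0 ≤ r} : S.MPplus y r hr ≤ S.MP y r hr :=
  S.congr_mono (Int.ceil_le_floor_add_one _) (Int.ceil_le_floor_add_one _)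
    (Int.ceil_le_floor_add_one _)

/-- The shift by one comes from the strict inequality in $\mathcal G_{0,n+}$: the least integer
greater than $n$ is $n+1$. -/
lemma MPplus_zero_natCast {n : ℕ} {hn : 0 ≤ (n : ℝ)} :
    S.MPplus 0 n hn = S.principal (n + 1) := by
  simp [MPplus, principal]

lemma principal_le_MPplus_zero {n : ℕ} {c : ℝ} {hc : 0 ≤ c} (h : c < n) :
    S.principal n ≤ S.MPplus 0 c hc := by
  have : ⌊c⌋ < n := Int.floor_lt.2 (by exact_mod_cast h)
  exact S.congr_mono (by lia) (by simp; lia) (by simp; lia)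

end Groups

/-! ### Valuations attached to the torus and to $\Gamma$ -/

section Torus

/-- As `X` is off-diagonal, only the off-diagonal entries of `g` enter and subtracting `1` has no
effect. -/
lemma trΓ_eq (T : TorusType) (a : k) (g : Matrix.SpecialLinearGroup (Fin 2) k) :
    S.trΓ T a g = a * S.γ₁ T * g 1 0 + a * S.γ₂ T * g 0 1 := by
  simp [trΓ, X, Matrix.trace_fin_two, Matrix.vecMul, dotProduct]

/-- This converts the valuation $-r-y$ of $\mathsf a\gamma_1$, given by genericity, into the
valuation $-(r-y)$ of $\mathsf a\gamma_2$. -/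
lemma exists_hasVal_γ (T : TorusType) :
    ∃ j : ℤ, (j : ℝ) = 2 * T.point ∧ S.HasVal (S.γ₂ T / S.γ₁ T) j := by
  have h1 := S.ϖ_ne_zero
  have h2 := S.ε_ne_zero
  cases T
  · exact ⟨0, by simp [TorusType.point], by simpa [γ₁, γ₂] using S.hasVal_ε⟩
  · refine ⟨2, by simp [TorusType.point], ?_⟩
    have := (S.hasVal_ε.mul S.hasVal_ϖ).mul S.hasVal_ϖ
    simpa [γ₁, γ₂] using this
  · exact ⟨1, by simp [TorusType.point], by simpa [γ₁, γ₂] using S.hasVal_ϖ⟩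
  · refine ⟨1, by simp [TorusType.point], ?_⟩
    have := (S.hasVal_ε.inv.mul S.hasVal_ϖ).mul S.hasVal_ε.inv
    simpa [γ₁, γ₂, div_eq_mul_inv] using this
  · exact ⟨1, by simp [TorusType.point], by simpa [γ₁, γ₂] using S.hasVal_ε.mul S.hasVal_ϖ⟩
  · refine ⟨1, by simp [TorusType.point], ?_⟩
    have := S.hasVal_ϖ.mul S.hasVal_ε.inv
    simpa [γ₁, γ₂, div_eq_mul_inv] using this

lemma γ₁_ne_zero (T : TorusType) : S.γ₁ T ≠ 0 := by
  have h1 := S.ϖ_ne_zero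
  have h2 := S.ε_ne_zero
  cases T <;> simp [γ₁, h1, h2]

/-- The valuations of the coefficients of `Tr (Γ (g - 1))`. -/
lemma IsGenericElement.exists_hasVal {T : TorusType} {r : ℝ} {a : k}
    (h : S.IsGenericElement T r a) :
    ∃ m n : ℤ, (m : ℝ) = r - T.point ∧ (n : ℝ) = r + T.point ∧
      S.HasVal (a * S.γ₁ T) (-n) ∧ S.HasVal (a * S.γ₂ T) (-m) := by
  obtain ⟨n, hn, hv⟩ := h
  obtain ⟨j, hj, hγ⟩ := S.exists_hasVal_γ T
  refine ⟨-n - j, -n, by push_cast; linarith, by push_cast; linarith, by simpa using hv, ?_⟩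
  have := hv.mul hγ
  rw [mul_assoc, mul_div_cancel₀ _ (S.γ₁_ne_zero T)] at this
  convert this using 1
  ring

end Torus

end Setup

/-! ### Heisenberg and Weil operators at central elements; unipotent test matrices -/

lemma heisenbergOp_zero {F : Type*} [Field F] (ψ : F → ℂ) (τ : F) (f : F → ℂ) :
    heisenbergOp ψ 0 0 τ f = ψ τ • f := by
  funext w
  simp [heisenbergOp]

lemma weilOp_one {F : Type*} [Field F] {ψ : F → ℂ} (hψ : ψ 0 = 1) (f : F → ℂ) :
    weilOp ψ 1 f = f := by
  funext w
  simp [weilOp, hψ]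

/-- A lower triangular unipotent matrix. -/
def lowerUnipotent {F : Type*} [Field F] (c : F) : Matrix.SpecialLinearGroup (Fin 2) F :=
  ⟨!![1, 0; c, 1], by simp [Matrix.det_fin_two]⟩

lemma coe_lowerUnipotent {F : Type*} [Field F] (c : F) :
    (lowerUnipotent c : Matrix (Fin 2) (Fin 2) F) = !![1, 0; c, 1] := rfl

/-- The nilpotent part $c\,p^{-1}E_{21}p$ has rank at most one and depends only on the first row of
`p`, quadratically. -/
lemma conj_lowerUnipotent {F : Type*} [Field F] (p : Matrix.SpecialLinearGroup (Fin 2) F)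
    (c : F) :
    ((p⁻¹ * lowerUnipotent c * p : Matrix.SpecialLinearGroup (Fin 2) F) :
      Matrix (Fin 2) (Fin 2) F) =
      !![1 - c * (p 0 0 * p 0 1), -(c * p 0 1 ^ 2); c * p 0 0 ^ 2, 1 + c * (p 0 0 * p 0 1)] := by
  have hdet : p 0 0 * p 1 1 - p 0 1 * p 1 0 = 1 := by
    rw [← Matrix.det_fin_two, p.det_coe]
  rw [Matrix.SpecialLinearGroup.coe_mul, Matrix.SpecialLinearGroup.coe_mul,
    Matrix.SpecialLinearGroup.coe_inv, coe_lowerUnipotent, Matrix.adjugate_fin_two,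
    Matrix.mul_fin_two]
  ext i j
  fin_cases i <;> fin_cases j <;> simp [Matrix.mul_apply, Fin.sum_univ_two]
  · linear_combination hdet
  · ring
  · ring
  · linear_combination hdet

namespace Setup

variable {S : Setup k}

/-! ### The representation $\rho$ on $\mathcal G_{y,r}$ -/

namespace GenericCharacter

variable {T : TorusType} {D : S.GenericCharacter T}

/-- Genericity makes $r-y$ and $r+y$ integers, so no rounding occurs and the levels of the entries
cancel the valuations of the coefficients exactly. -/
lemma trΓ_mem_P_zero {a : k} (ha : S.IsGenericElement T D.r a)
    {h : Matrix.SpecialLinearGroup (Fin 2) k} (hh : h ∈ S.MP T.point D.r D.r_pos.le) :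
    S.trΓ T a h ∈ S.P 0 := by
  obtain ⟨m, n, hm, hn, h1, h2⟩ := ha.exists_hasVal
  obtain ⟨-, -, h01, h10⟩ := hh
  rw [← hm, Int.ceil_intCast] at h01
  rw [← hn, Int.ceil_intCast] at h10
  rw [trΓ_eq]
  exact add_mem (S.mul_mem_P_of_le (by lia) h1.mem_P h10) (S.mul_mem_P_of_le (by lia) h2.mem_P h01)

lemma trΓ_mem_P_one {a : k} (ha : S.IsGenericElement T D.r a)
    {h : Matrix.SpecialLinearGroup (Fin 2) k} (hh : h ∈ S.MPplus T.point D.r D.r_pos.le) :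
    S.trΓ T a h ∈ S.P 1 := by
  obtain ⟨m, n, hm, hn, h1, h2⟩ := ha.exists_hasVal
  obtain ⟨-, -, h01, h10⟩ := hh
  rw [← hm, Int.floor_intCast] at h01
  rw [← hn, Int.floor_intCast] at h10
  rw [trΓ_eq]
  exact add_mem (S.mul_mem_P_of_le (by lia) h1.mem_P h10) (S.mul_mem_P_of_le (by lia) h2.mem_P h01)

lemma MP_le_Gs : S.MP T.point D.r D.r_pos.le ≤ D.Gs :=
  S.MP_mono (by unfold s; linarith [D.r_pos])

lemma MP_le_J : S.MP T.point D.r D.r_pos.le ≤ D.J := MP_le_Gs.trans le_sup_right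

/-- In the Heisenberg case, `𝒢_{y, r}` maps to the centre of the Heisenberg group. -/
lemma coords_eq_zero (hD : D.IsHeisenberg) {a : k} (ha : S.IsGenericElement T D.r a)
    {h : Matrix.SpecialLinearGroup (Fin 2) k} (hh : h ∈ S.MP T.point D.r D.r_pos.le) :
    D.pCoord h = 0 ∧ D.qCoord a h = 0 := by
  obtain ⟨-, n, hn⟩ := hD
  have hn0 : 0 < n := by
    have := D.r_pos
    rw [hn] at this
    exact_mod_cast pos_of_mul_pos_right this zero_le_two
  have hs : ⌈D.s⌉ = n := by simp [s, hn]
  obtain ⟨m', n', hm, hn', h1, h2⟩ := ha.exists_hasVal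
  obtain ⟨h00, -, h01, h10⟩ := hh
  rw [← hm, Int.ceil_intCast] at h01
  rw [← hn', Int.ceil_intCast] at h10
  rw [show D.r = ((2 * n : ℤ) : ℝ) by rw [hn]; push_cast; ring, Int.ceil_intCast] at h00
  rw [pCoord, qCoord, hs]
  constructor
  -- Here $s=n$ and $r=2n$ with $n>0$, so dividing an element of $\mathcal P^{2n}$ by $\varpi^n$
  -- still leaves it in $\mathcal P$.
  · exact S.red_eq_zero (S.mul_mem_P_of_le (by lia) (S.zpow_mem_P _) h00)
  -- The bracket is integral on $\mathcal G_{y,r}$, and the factor $\varpi^n$ puts the product in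
  -- $\mathcal P$.
  · refine S.red_eq_zero (S.mul_mem_P_of_le (n := 0) (by lia) (S.zpow_mem_P n) ?_)
    have h3 : a * S.γ₂ T * h 0 1 - a * S.γ₁ T * h 1 0 ∈ S.P 0 :=
      sub_mem (S.mul_mem_P_of_le (by lia) h2.mem_P h01) (S.mul_mem_P_of_le (by lia) h1.mem_P h10)
    convert add_mem h3 h3 using 1
    ring

variable {V : Type*} [AddCommGroup V] [Module ℂ V]

/-- On `𝒢_{y, r}`, the representation `ρ` is the character `Ψ_Γ`. -/
lemma IsRho.exists_apply_eq {ρ : Representation ℂ D.J V} (hρ : D.IsRho ρ) :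
    ∃ a : k, S.IsGenericElement T D.r a ∧ ∀ (h : Matrix.SpecialLinearGroup (Fin 2) k)
      (hh : h ∈ S.MP T.point D.r D.r_pos.le) (v : V),
      ρ ⟨h, MP_le_J hh⟩ v = S.Ψ (S.trΓ T a h) • v := by
  obtain ⟨a, ⟨ha, -⟩, h1, h2⟩ := hρ
  refine ⟨a, ha, fun h hh v => ?_⟩
  by_cases hD : D.IsHeisenberg
  · obtain ⟨Φ, hΦ⟩ := h2 hD
    have htr := S.mem_P_zero.1 (trΓ_mem_P_zero ha hh)
    -- With `t = 1` and `M = 1` the Weil operator is the identity, and both symplectic coordinates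
    -- of `h` vanish, so only the central character remains.
    have := hΦ 1 1 (fun g _ => by simp) h ⟨MP_le_Gs hh, htr⟩ v
    obtain ⟨hp, hq⟩ := coords_eq_zero hD ha hh
    rw [hp, hq, heisenbergOp_zero, weilOp_one S.ψ_zero, S.ψ_red htr, map_one, Units.val_one,
      one_smul, ← map_smul] at this
    simpa using Φ.injective this
  · simpa using (h1 hD).2 1 ⟨h, MP_le_Gs hh⟩ v

lemma IsRho.nontrivial {ρ : Representation ℂ D.J V} (hρ : D.IsRho ρ) : Nontrivial V := by
  obtain ⟨a, -, h1, h2⟩ := hρ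
  by_cases hD : D.IsHeisenberg
  · obtain ⟨Φ, -⟩ := h2 hD
    exact Φ.toEquiv.nontrivial
  · exact Module.nontrivial_of_finrank_pos (R := ℂ) (by rw [(h1 hD).1]; exact one_pos)

end GenericCharacter

/-! ### Conjugation by the double coset representatives -/

section DoubleCosets

lemma α_conj (t : ℕ) (g : Matrix.SpecialLinearGroup (Fin 2) k) :
    (((S.α t)⁻¹ * g * S.α t : Matrix.SpecialLinearGroup (Fin 2) k) :
      Matrix (Fin 2) (Fin 2) k) =
      !![g 0 0, (S.ϖ : k) ^ (2 * t : ℤ) * g 0 1; (S.ϖ : k) ^ (-2 * t : ℤ) * g 1 0, g 1 1] := by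
  have h0 := S.ϖ_ne_zero
  have h2 : (S.ϖ : k) ^ (2 * t : ℤ) = (S.ϖ : k) ^ t * (S.ϖ : k) ^ t := by
    rw [two_mul, zpow_add₀ h0, zpow_natCast]
  have hα : (S.α t : Matrix (Fin 2) (Fin 2) k) =
      !![(S.ϖ : k) ^ (-(t : ℤ)), 0; 0, (S.ϖ : k) ^ t] := rfl
  rw [Matrix.SpecialLinearGroup.coe_mul, Matrix.SpecialLinearGroup.coe_mul,
    Matrix.SpecialLinearGroup.coe_inv, hα, Matrix.adjugate_fin_two_of]
  ext i j
  fin_cases i <;> fin_cases j <;> simp [Matrix.mul_apply, Matrix.vecMul, dotProduct, h2]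
  all_goals field_simp

lemma α_conj_lowerUnipotent (t : ℕ) (c : k) :
    S.α t * lowerUnipotent c * (S.α t)⁻¹ = lowerUnipotent ((S.ϖ : k) ^ (2 * t : ℤ) * c) := by
  have h0 := zpow_ne_zero (2 * t : ℤ) S.ϖ_ne_zero
  have : (S.α t)⁻¹ * lowerUnipotent ((S.ϖ : k) ^ (2 * t : ℤ) * c) * S.α t = lowerUnipotent c := by
    apply Subtype.ext
    rw [α_conj, coe_lowerUnipotent, coe_lowerUnipotent]
    simp [zpow_neg, h0]
  rw [← this]
  group

lemma lowerUnipotent_mem_principal {m : ℕ} {c : k} (hc : c ∈ S.P m) :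
    lowerUnipotent c ∈ S.principal m := by
  rw [principal, mem_congr, coe_lowerUnipotent]
  simp [zero_mem, hc]

variable (S) in
/-- The entries of the nontrivial element of `Λ(𝒯)`, depending on the type of the torus. -/
lemma d_cases (T : TorusType) :
    (∃ y : ℤ, 0 ≤ y ∧ (y : ℝ) = T.point ∧ S.d T ∈ S.congr 0 (-y) y le_rfl (by lia) ∧
      S.γ₁ T * S.d T 0 0 ^ 2 - S.γ₂ T * S.d T 0 1 ^ 2 = S.γ₁ T * S.ε) ∨
    (T.point = 1 / 2 ∧ (S.d T : Matrix (Fin 2) (Fin 2) k) = !![0, 1; -1, 0]) := by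
  have h0 := S.ϖ_ne_zero
  have h2 := S.ε_ne_zero
  have h := congrArg (Subtype.val) S.sq_sub_eq
  push_cast at h
  have hε : (S.ε : k)⁻¹ ∈ S.P 0 := by simpa using S.hasVal_ε.inv.mem_P
  have hx : (S.x : k) ∈ S.P 0 := S.mem_P_zero.2 S.x.2
  have hy : (S.y : k) ∈ S.P 0 := S.mem_P_zero.2 S.y.2
  have h1 : (1 : k) ∈ S.P 0 := S.mem_P_zero.2 (one_mem _)
  have hx' : (S.ε : k)⁻¹ * S.x - 1 ∈ S.P 0 :=
    sub_mem (S.mul_mem_P_of_le (by lia) hε hx) h1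
  cases T
  · have hd : (S.d .unram0 : Matrix (Fin 2) (Fin 2) k) =
      !![(S.x : k), S.y; S.y, (S.ε : k)⁻¹ * S.x] := rfl
    refine Or.inl ⟨0, le_rfl, by simp [TorusType.point], ?_, ?_⟩
    · rw [mem_congr, hd]
      exact ⟨sub_mem hx h1, hx', hy, hy⟩
    -- This is the equation $x_0^2-\varepsilon y_0^2=\varepsilon$. It ensures that conjugation by
    -- $\mathsf d$ changes the upper right entry of $\Gamma$ only by a unit.
    · rw [hd]
      simpa [γ₁, γ₂] using h
  · have hd : (S.d .unram1 : Matrix (Fin 2) (Fin 2) k) =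
      !![(S.x : k), S.y * (S.ϖ : k)⁻¹; S.ϖ * S.y, (S.ε : k)⁻¹ * S.x] := rfl
    have hϖy : (S.y : k) * (S.ϖ : k)⁻¹ ∈ S.P (-1) :=
      S.mul_mem_P_of_le (by lia) hy S.hasVal_ϖ.inv.mem_P
    have hϖy' : (S.ϖ : k) * S.y ∈ S.P 1 := S.mul_mem_P_of_le (by lia) S.hasVal_ϖ.mem_P hy
    refine Or.inl ⟨1, zero_le_one, by simp [TorusType.point], ?_, ?_⟩
    · rw [mem_congr, hd]
      exact ⟨sub_mem hx h1, hx', hϖy, hϖy'⟩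
    · rw [hd]
      simp only [γ₁, γ₂, Matrix.of_apply, Matrix.cons_val', Matrix.cons_val_zero,
        Matrix.cons_val_one, Matrix.cons_val_fin_one]
      field_simp
      linear_combination h
  all_goals exact Or.inr ⟨rfl, rfl⟩

/-- The factor in front of `c` is the upper right entry of $p\Gamma p^{-1}$, by invariance of the
trace under conjugation. -/
lemma trΓ_conj_lowerUnipotent (T : TorusType) (a c : k)
    (p : Matrix.SpecialLinearGroup (Fin 2) k) :
    S.trΓ T a (p⁻¹ * lowerUnipotent c * p) =
      a * (S.γ₁ T * p 0 0 ^ 2 - S.γ₂ T * p 0 1 ^ 2) * c := by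
  rw [trΓ_eq, conj_lowerUnipotent]
  simp
  ring

lemma point_nonneg (T : TorusType) : 0 ≤ T.point := by
  cases T <;> simp [TorusType.point]

open Classical in
/-- Conjugation by an element `λ` of `Λ(𝒯)`, relative to the filtration. -/
lemma GenericCharacter.exists_level {T : TorusType} (D : S.GenericCharacter T) {a : k}
    (ha : S.IsGenericElement T D.r a) (t : ℕ) (b : Bool) (hb : b = true → 0 < t) :
    ∃ (N : ℤ) (hN : 0 ≤ N), (N : ℝ) + 2 * t =
        D.r + (if T.point = 1 / 2 ∧ b = true then 2 * t - T.point else 2 * t + T.point) ∧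
      (∀ g ∈ S.congr (N + 2 * t + 1) (N + 4 * t + 1) (N + 1) (by lia) (by lia),
        (if b then S.d T else 1)⁻¹ * g * (if b then S.d T else 1) ∈
          S.MPplus T.point D.r D.r_pos.le) ∧
      S.HasVal (a * (S.γ₁ T * (if b then S.d T else 1 : Matrix.SpecialLinearGroup _ _) 0 0 ^ 2 -
        S.γ₂ T * (if b then S.d T else 1 : Matrix.SpecialLinearGroup _ _) 0 1 ^ 2)) (-N) ∧
      ∀ c ∈ S.P N, (if b then S.d T else 1)⁻¹ * lowerUnipotent c * (if b then S.d T else 1) ∈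
        S.MP T.point D.r D.r_pos.le := by
  obtain ⟨m, n, hm, hn, h1, h2⟩ := ha.exists_hasVal
  have hr := D.r_pos
  have hp := point_nonneg T
  have hn0 : 0 ≤ n := by
    have : (0 : ℝ) ≤ n := by rw [hn]; linarith
    exact_mod_cast this
  -- Since $y\ge 0$, the integer $n=r+y$ dominates $r$ and $r-y$, so the lower left entry imposes
  -- the strongest condition.
  have hmn : ⌈D.r⌉ ≤ n := Int.ceil_le.2 (by linarith)
  have hfloor : ⌊D.r⌋ ≤ n := (Int.floor_le_ceil _).trans hmn
  have hle : S.congr (n + 2 * t + 1) (n + 4 * t + 1) (n + 1) (by lia) (by lia) ≤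
      S.MPplus T.point D.r D.r_pos.le := by
    have : m ≤ n := by
      have : (m : ℝ) ≤ n := by linarith
      exact_mod_cast this
    refine S.congr_mono (by lia) ?_ ?_
    · rw [← hm, Int.floor_intCast]; lia
    · rw [← hn, Int.floor_intCast]
  have mem_MP : ∀ p : Matrix.SpecialLinearGroup (Fin 2) k, ∀ c : k,
      c * (p 0 0 * p 0 1) ∈ S.P ⌈D.r⌉ → c * p 0 1 ^ 2 ∈ S.P m → c * p 0 0 ^ 2 ∈ S.P n →
      p⁻¹ * lowerUnipotent c * p ∈ S.MP T.point D.r D.r_pos.le := by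
    intro p c hc1 hc2 hc3
    rw [MP, mem_congr, conj_lowerUnipotent, ← hm, ← hn, Int.ceil_intCast, Int.ceil_intCast]
    refine ⟨?_, ?_, ?_, ?_⟩
    · simpa using hc1
    · simpa using hc1
    · simpa using hc2
    · simpa using hc3
  cases b with
  | false =>
    refine ⟨n, hn0, ?_, ?_, ?_, ?_⟩
    · simp only [Bool.false_eq_true, and_false, if_false]
      linarith
    · intro g hg
      simpa using hle hg
    · simpa using h1
    · intro c hc
      simp only [Bool.false_eq_true, if_false]
      exact mem_MP _ _ (by simp [zero_mem]) (by simp [zero_mem]) (by simpa using hc)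
  | true =>
    simp only [if_true, and_true]
    rcases S.d_cases T with ⟨y, hy0, hy, hd, hγ⟩ | ⟨hT, hd⟩
    · have hT : T.point ≠ 1 / 2 := by
        rw [← hy]
        intro h
        have h' : (2 * y : ℤ) = 1 := by
          have : (2 * y : ℝ) = 1 := by rw [h]; norm_num
          exact_mod_cast this
        lia
      have hrn : D.r = ((n - y : ℤ) : ℝ) := by push_cast; linarith
      have hmy : m = n - y - y := by
        have : (m : ℝ) = ((n - y - y : ℤ) : ℝ) := by push_cast; linarith
        exact_mod_cast this
      refine ⟨n, hn0, ?_, ?_, ?_, ?_⟩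
      · rw [if_neg hT]
        linarith
      -- The element $\mathsf d$ lies in the parahoric subgroup at $y$, hence normalizes $\mathcal
      -- G_{y,r+}$.
      · intro g hg
        have := S.conj_mem_congr (y := y) ?_ ?_ (inv_mem hd) (hle hg)
        · rw [inv_inv] at this
          exact this
        · rw [← hm, hrn, Int.floor_intCast, Int.floor_intCast]
          lia
        · rw [← hn, hrn, Int.floor_intCast, Int.floor_intCast]
          lia
      · rw [hγ, ← mul_assoc]
        simpa using h1.mul S.hasVal_ε
      · intro c hc
        obtain ⟨d00, -, d01, -⟩ := hd
        have d00 : S.d T 0 0 ∈ S.P 0 := by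
          simpa using add_mem d00 (S.mem_P_zero.2 (one_mem _))
        refine mem_MP _ _ ?_ ?_ ?_
        · rw [hrn, Int.ceil_intCast]
          exact S.mul_mem_P_of_le (by lia) hc (S.mul_mem_P d00 d01)
        · rw [pow_two]
          exact S.mul_mem_P_of_le (by lia) hc (S.mul_mem_P d01 d01)
        · rw [pow_two]
          exact S.mul_mem_P_of_le (by lia) hc (S.mul_mem_P d00 d00)
    · have ht := hb rfl
      -- Now $y=\tfrac12$, so $r$ is a half-integer between $m=r-y$ and $n=r+y$. As $w$ interchanges
      -- the off-diagonal entries, the level is $N=m$.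
      have hmn' : n = m + 1 := by
        have : (n : ℝ) = ((m + 1 : ℤ) : ℝ) := by push_cast; linarith
        exact_mod_cast this
      have hfm : ⌊D.r⌋ = m := by
        rw [Int.floor_eq_iff]
        constructor <;> linarith
      refine ⟨m, by rw [← hfm]; exact Int.floor_nonneg.2 hr.le, ?_, ?_, ?_, ?_⟩
      · rw [if_pos hT]
        linarith
      · rintro g ⟨g00, g11, g01, g10⟩
        rw [MPplus, mem_congr, ← hm, ← hn, Int.floor_intCast, Int.floor_intCast, hfm]
        rw [Matrix.SpecialLinearGroup.coe_mul, Matrix.SpecialLinearGroup.coe_mul,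
          Matrix.SpecialLinearGroup.coe_inv, hd, Matrix.adjugate_fin_two_of]
        simp only [Matrix.mul_apply, Fin.sum_univ_two, Matrix.of_apply, Matrix.cons_val',
          Matrix.cons_val_zero, Matrix.cons_val_one, Matrix.cons_val_fin_one]
        refine ⟨?_, ?_, ?_, ?_⟩
        · simpa using S.P_mono (by lia) g11
        · simpa using S.P_mono (by lia) g00
        · simpa using g10
        -- The old upper right entry must now lie in $\mathcal P^{n+1}=\mathcal P^{N+2}$; this needs
        -- $4t\ge 1$, hence $t>0$.
        · simpa using S.P_mono (by lia) g01
      · rw [hd]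
        obtain ⟨u, hu, hu'⟩ := h2
        refine ⟨-u, hu.neg, ?_⟩
        push_cast
        rw [mul_neg, ← hu']
        simp
      · intro c hc
        refine mem_MP _ _ ?_ ?_ ?_ <;> rw [hd]
        · simp [zero_mem]
        · simpa using hc
        · simp [zero_mem]

open Classical in
lemma exists_toSL_eq (μ : CosetRep) (T : TorusType) :
    ∃ (t : ℕ) (b : Bool), (b = true → 0 < t) ∧
      μ.toSL S T = S.α t * (if b then S.d T else 1) ∧
      μ.δ T = if T.point = 1 / 2 ∧ b = true then 2 * t - T.point else 2 * t + T.point := by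
  cases μ with
  | one =>
    refine ⟨0, false, by simp, ?_, by simp [CosetRep.δ]⟩
    have : S.α 0 = 1 := by
      apply Subtype.ext
      simp [α, Matrix.one_fin_two]
    simp [CosetRep.toSL, this]
  | mk t ht b => exact ⟨t, b, fun _ => ht, rfl, rfl⟩

/-- The target records the exact levels $m$, $m+2t$, $m-2t$ of the entries after conjugation, for
$m=N+2t+1$. -/
lemma α_conj_mem {N : ℤ} {t : ℕ} (hN : 0 ≤ N) {m : ℕ} (hm : (m : ℤ) = N + 2 * t + 1)
    {g : Matrix.SpecialLinearGroup (Fin 2) k} (hg : g ∈ S.principal m) :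
    (S.α t)⁻¹ * g * S.α t ∈
      S.congr (N + 2 * t + 1) (N + 4 * t + 1) (N + 1) (by lia) (by lia) := by
  obtain ⟨g00, g11, g01, g10⟩ := hg
  rw [hm] at *
  rw [mem_congr, α_conj]
  exact ⟨g00, g11, S.mul_mem_P_of_le (by lia) (S.zpow_mem_P _) g01,
    S.mul_mem_P_of_le (by lia) (S.zpow_mem_P _) g10⟩

end DoubleCosets

/-! ### The exact level and the maximal depth -/

section Main

variable {T : TorusType} {D : S.GenericCharacter T} {V : Type*} [AddCommGroup V] [Module ℂ V]

/-- `r + δ(μ)` is the exact level from which on the principal congruence subgroups act trivially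
on the Mackey component at `μ`. -/
lemma exists_level_mackeyComponent {ρ : Representation ℂ D.J V} (hρ : D.IsRho ρ) (μ : CosetRep) :
    ∃ n : ℕ, (n : ℝ) = D.r + μ.δ T ∧
      (∀ g ∈ (S.principal (n + 1)).subgroupOf S.K,
        mackeyComponent S.K D.J ρ (μ.toSL S T) g = 1) ∧
      ∃ g ∈ (S.principal n).subgroupOf S.K, ∃ f,
        mackeyComponent S.K D.J ρ (μ.toSL S T) g f ≠ f := by
  obtain ⟨a, ha, hρa⟩ := hρ.exists_apply_eq
  obtain ⟨t, b, hb, hμ, hδ⟩ := exists_toSL_eq (S := S) μ T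
  obtain ⟨N, hN, hNr, hplus, hval, hMP⟩ := D.exists_level ha t b hb
  rw [← hδ] at hNr
  set l : Matrix.SpecialLinearGroup (Fin 2) k := if b then S.d T else 1
  have hconj : ∀ g : Matrix.SpecialLinearGroup (Fin 2) k,
      (μ.toSL S T)⁻¹ * g * μ.toSL S T = l⁻¹ * ((S.α t)⁻¹ * g * S.α t) * l := by
    intro g
    rw [hμ]
    group
  obtain ⟨n, hn⟩ := Int.eq_ofNat_of_zero_le (show 0 ≤ N + 2 * t by lia)
  refine ⟨n, ?_, fun g hg => mackeyComponent_eq_one (fun g hg => ?_) hg, ?_⟩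
  · rw [← hNr]
    exact_mod_cast hn.symm
  · rw [Subgroup.mem_subgroupOf] at hg
    have h1 := hplus _ (α_conj_mem hN (by push_cast; lia) hg)
    rw [← hconj] at h1
    refine ⟨GenericCharacter.MP_le_J (S.MPplus_le_MP h1), ?_⟩
    ext v
    rw [hρa _ (S.MPplus_le_MP h1), S.Ψ_eq_one (GenericCharacter.trΓ_mem_P_one ha h1), one_smul]
    rfl
  · obtain ⟨z, hz⟩ := S.Ψ_integers
    -- The trace on $\lambda^{-1}u\lambda$, for $u$ lower unipotent with entry $c$, is $ec$. Taking
    -- $c=e^{-1}z$ makes it equal to $z$, and $\mathrm{val}(e)=-N$ gives $c\in\mathcal P^N$.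
    -- Conjugating $u$ by $\alpha^t$ turns the entry into $\varpi^{2t}c\in\mathcal P^n$.
    set e := a * (S.γ₁ T * l 0 0 ^ 2 - S.γ₂ T * l 0 1 ^ 2) with he
    have hc : e⁻¹ * z ∈ S.P N := by
      refine S.mul_mem_P_of_le (by lia) hval.inv.mem_P (S.mem_P_zero.2 z.2)
    have hg : lowerUnipotent ((S.ϖ : k) ^ (2 * t : ℤ) * (e⁻¹ * z)) ∈ S.principal n :=
      lowerUnipotent_mem_principal (S.mul_mem_P_of_le (by lia) (S.zpow_mem_P _) hc)
    obtain ⟨v, hv⟩ := @exists_ne _ hρ.nontrivial (0 : V)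
    have hback : (μ.toSL S T)⁻¹ * lowerUnipotent ((S.ϖ : k) ^ (2 * t : ℤ) * (e⁻¹ * z)) *
        μ.toSL S T = l⁻¹ * lowerUnipotent (e⁻¹ * z) * l := by
      rw [hconj, ← α_conj_lowerUnipotent]
      group
    have hmem := hMP _ hc
    have htr : S.trΓ T a (l⁻¹ * lowerUnipotent (e⁻¹ * z) * l) = z := by
      rw [trΓ_conj_lowerUnipotent, ← he, mul_inv_cancel_left₀ hval.ne_zero]
    rw [← hback] at hmem htr
    refine ⟨⟨_, S.principal_le_K n hg⟩, hg, exists_mackeyComponent_ne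
      (GenericCharacter.MP_le_J hmem) (v := v) ?_⟩
    rw [hρa _ hmem, htr]
    intro h
    apply hz
    have h' : (S.Ψ z - 1) • v = 0 := by rw [sub_smul, h, one_smul, sub_self]
    exact sub_eq_zero.1 ((smul_eq_zero.1 h').resolve_right hv)

/-- If `n` is the exact level from which on the principal congruence subgroups act trivially, then
`n` is the maximal depth of a component. -/
lemma isGreatest_componentDepths {A : Type*} [AddCommGroup A] [Module ℂ A]
    (σ : Representation ℂ S.K A) (n : ℕ)
    (h1 : ∀ g ∈ (S.principal (n + 1)).subgroupOf S.K, σ g = 1) {g : S.K}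
    (hg : g ∈ (S.principal n).subgroupOf S.K) {v : A} (hv : σ g v ≠ v) :
    IsGreatest (componentDepths S σ) n := by
  have hmem : ∀ W : Subrepresentation σ, W.toRepresentation.IsIrreducible →
      (n : ℝ) ∈ {c : ℝ | ∃ hc : 0 ≤ c, ∃ v : W.toSubmodule, v ≠ 0 ∧
        ∀ g : S.K, (g : Matrix.SpecialLinearGroup (Fin 2) k) ∈ S.MPplus 0 c hc →
          W.toRepresentation g v = v} := by
    intro W hW
    obtain ⟨w, hw⟩ : ∃ w : W.toSubmodule, w ≠ 0 := by
      by_contra! h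
      apply bot_ne_top (α := Subrepresentation W.toRepresentation)
      apply Subrepresentation.toSubmodule_injective
      ext x
      rw [h x]
      simp only [zero_mem]
    refine ⟨n.cast_nonneg, w, hw, fun g hg => Subtype.ext ?_⟩
    rw [MPplus_zero_natCast] at hg
    change σ g w = w
    rw [h1 g hg, Module.End.one_apply]
  constructor
  · obtain ⟨W, hW, hfix⟩ := exists_irreducible_no_fixed σ _ _ h1 hg hv
    refine ⟨W, hW, hmem W hW, ?_⟩
    rintro c ⟨hc, w, hw, hwc⟩
    by_contra! hcn
    -- For real $c<n$ one has $\lfloor c\rfloor+1\le n$, so a $\mathcal G_{0,c+}$-fixed vector is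
    -- also fixed by the principal congruence subgroup of level $n$.
    exact hw (Subtype.ext (hfix w w.2 fun g hg =>
      congrArg Subtype.val (hwc g (S.principal_le_MPplus_zero hcn hg))))
  · rintro c ⟨W, hW, hc⟩
    exact hc.2 (hmem W hW)

end Main

end Setup

end SL2Branching

theorem proposition4p7 {k : Type*} [Field k] [ValuativeRel k] [TopologicalSpace k]
    [IsNonarchimedeanLocalField k] (hp : ringChar 𝓀[k] ≠ 2)
    (S : SL2Branching.Setup k) (T : SL2Branching.TorusType) (D : S.GenericCharacter T)
    {V : Type*} [AddCommGroup V] [Module ℂ V] (ρ : Representation ℂ D.J V) (hρ : D.IsRho ρ)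
    (μ : SL2Branching.CosetRep) :
    IsGreatest
      (SL2Branching.componentDepths S (SL2Branching.mackeyComponent S.K D.J ρ (μ.toSL S T)))
      (D.r + μ.δ T) := by
  obtain ⟨n, hn, h1, g, hg, f, hf⟩ := SL2Branching.Setup.exists_level_mackeyComponent hρ μ
  rw [← hn]
  exact SL2Branching.Setup.isGreatest_componentDepths _ n h1 hg hf
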